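/- Let $\mathbb K$ be $\mathbb R$ or $\mathbb C$, let $X$ be a Hausdorff topological vector space over $\mathbb K$, and let $\{T_t\}_{t\ge 0}$ be a semigroup of continuous linear operators on $X$, that is, $T_0=I$ and $T_{s+t}=T_sT_t$ for all $s,t\ge 0$. For a continuous linear operator $T$ on $X$ let $\mathcal U(T)$ denote the set of its hypercyclic vectors, i.e. of those $x\in X$ for which $\{T^nx : n=0,1,2,\dots\}$ is dense in $X$; $T$ is called hypercyclic if $\mathcal U(T)\neq\varnothing$. (1) Suppose that the map $(t,x)\mapsto T_tx$ from $[0,\infty)\times X$ to $X$ is continuous. Then $\mathcal U(T_t)=\mathcal U(T_s)$ for all $t,s>0$. That is, either no $T_t$ with $t>0$ is hypercyclic, or all $T_t$ with $t>0$ are hypercyclic and have the same set of hypercyclic vectors. (2) (Conejero–Müller–Peris theorem) Suppose that $X$ is a Baire, separable and metrizable space, that $\{T_t\}_{t\ge0}$ is strongly continuous, i.e. $t\mapsto T_tx$ is continuous on $[0,\infty)$ for each $x\in X$, and that the family $\{T_t:t\ge 0\}$ is universal, i.e. there is $x\in X$ for which $\{T_tx:t\ge0\}$ is dense in $X$. Then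 each $T_t$ with $t>0$ is hypercyclic, and all $T_t$ with $t>0$ have the same set of hypercyclic vectors. -/

import Mathlib

open scoped NNReal

/-- The set `𝒰(F)` of universal elements of a family `F = {F_a : a ∈ A}` of maps from `X` to `Y`:
those `x` for which the orbit `{F_a x : a ∈ A}` is dense in `Y`. -/
def universalElements {A X Y : Type*} [TopologicalSpace Y] (F : A → X → Y) : Set X :=
  {x | Dense (Set.range fun a => F a x)}

/-- A family of maps is universal if it has a universal element. -/
def IsUniversalFamily {A X Y : Type*} [TopologicalSpace Y] (F : A → X → Y) : Prop :=
  (universalElements F).Nonempty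

/-- The set `𝒰(T)` of universal elements of a single self-map `T`, that is, of the family of its
iterates `{T^n : n = 0, 1, 2, …}`. -/
def iterateUniversalElements {X : Type*} [TopologicalSpace X] (T : X → X) : Set X :=
  universalElements fun n : ℕ => T^[n]

section

variable {𝕜 X : Type*} [RCLike 𝕜] [AddCommGroup X] [Module 𝕜 X] [TopologicalSpace X]

/-- The hypercyclic vectors of a continuous linear operator are its universal elements. -/
def hypercyclicVectors (T : X →L[𝕜] X) : Set X :=
  iterateUniversalElements (T : X → X)

/-- A continuous linear operator is hypercyclic if it has a hypercyclic vector. -/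
def IsHypercyclic (T : X →L[𝕜] X) : Prop :=
  (hypercyclicVectors T).Nonempty

/-- `{T_t}_{t ≥ 0}` is a (one-parameter) semigroup of continuous linear operators. -/
structure IsOperatorSemigroup (T : ℝ≥0 → X →L[𝕜] X) : Prop where
  map_zero : T 0 = ContinuousLinearMap.id 𝕜 X
  map_add : ∀ s t : ℝ≥0, T (s + t) = (T s).comp (T t)

/-- Strong continuity: every orbit map `t ↦ T_t x` is continuous on `[0, ∞)`. -/
def IsStronglyContinuous (T : ℝ≥0 → X →L[𝕜] X) : Prop :=
  ∀ x : X, Continuous fun t : ℝ≥0 => T t x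

end

/-!
Let `U` be the set of universal vectors of the semigroup. Always `𝒰(T_p) ⊆ U`, and it is shown that
`U ⊆ 𝒰(T_p)` for each `p > 0`, so that all the sets `𝒰(T_p)` coincide.

For `x ∈ U`, consider the closure of the set of pairs `(T_t x, t mod p)` in `X × ℝ/pℤ`
(`phaseClosure`). If it is the whole space, then some `T_t x` with `t` slightly less than a multiple
`n p` is close to a given vector `z`, and continuity of `(t, y) ↦ T_t y` at `(0, z)` makes
`T_{n p} x` close to `z` (`IsOperatorSemigroup.mem_hypercyclicVectors`). This continuity is assumed
in the first part; in the second it follows from strong continuity by a Baire category argument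
(`IsStronglyContinuous.continuousAt_zero`).

The phases over `x` itself form a closed submonoid of the circle, and if it is the whole circle, then
so is the set of phases over every vector. Otherwise this submonoid is `k`-torsion for some
`k > 0`, and `k` times the phase is a continuous function `f : U → ℝ/pℤ` with
`f (T_t x) = k t mod p`. This is impossible for topological reasons
(`IsOperatorSemigroup.not_forall_returnPhases_nsmul_eq_zero`): the vectors `(1 - b) T_s x + b x` all
lie in `U`, because `(1 - b) T_s + b I` has dense range
(`IsOperatorSemigroup.denseRange_segmentOperator`), and they form a cone that contracts the orbit to
`x`. If `s` is a large time at which the orbit returns close to `x`, then the orbit up to time `s`,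
closed by the short segment from `T_s x` to `x`, is a loop contractible in `U` along which `f` has
nonzero winding number.
-/

open Filter Topology Set
open scoped Pointwise

/-! ### Lifts to the line and closed submonoids of the circle -/

section Lifting

/-- Uniqueness of lifts from the circle to the line. -/
theorem AddCircle.eq_of_coe_comp_eq {p : ℝ} [Fact (0 < p)] {A : Type*} [TopologicalSpace A]
    [PreconnectedSpace A] {g h : A → ℝ} (hg : Continuous g) (hh : Continuous h)
    (hgh : ∀ a, (g a : AddCircle p) = h a) (a₀ : A) (h₀ : g a₀ = h a₀) : g = h :=
  (AddCircle.isCoveringMap_coe p).eq_of_comp_eq hg hh (funext hgh) a₀ h₀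

/-- A winding number argument: if a map of the plane to the circle is constant on the lines
`{0} × ℝ` and `ℝ × {1}` and winds at speed `k` along `[0, ∞) × {0}`, then its lift to `ℝ` increases
by at least `p` along a vertical segment `{r} × [0, 1]` with `r ≥ p` (traversed downwards), so the
map passes through the antipode of `0` there. -/
theorem AddCircle.exists_eq_half_of_square {p : ℝ} [Fact (0 < p)]
    (G : ℝ × ℝ → AddCircle p) (hG : Continuous G) (hleft : ∀ b, G (0, b) = 0)
    (htop : ∀ a, G (a, 1) = 0) {k : ℕ} (hk : 0 < k)
    (hbot : ∀ a, 0 ≤ a → G (a, 0) = ((k * a : ℝ) : AddCircle p)) {r : ℝ} (hr : p ≤ r) :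
    ∃ b ∈ Icc (0 : ℝ) 1, G (r, b) = ((p / 2 : ℝ) : AddCircle p) := by
  have hp : 0 < p := Fact.out
  obtain ⟨φ, ⟨h0, hφ⟩, -⟩ := (AddCircle.isCoveringMap_coe p).existsUnique_continuousMap_lifts
    (⟨G, hG⟩ : C(ℝ × ℝ, AddCircle p)) (0, 0) 0 (by simp [hleft])
  have hφ' : ∀ z, (φ z : AddCircle p) = G z := fun z => congrFun hφ z
  have hl : (fun b : ℝ => φ (0, b)) = fun _ => 0 :=
    AddCircle.eq_of_coe_comp_eq (p := p) (by fun_prop) continuous_const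
      (fun b => by simp [hφ', hleft]) 0 h0
  have ht : (fun a : ℝ => φ (a, 1)) = fun _ => 0 :=
    AddCircle.eq_of_coe_comp_eq (p := p) (by fun_prop) continuous_const
      (fun a => by simp [hφ', htop]) 0 (congrFun hl 1)
  -- `hbot` holds only for `a ≥ 0`; the truncation extends it to the connected space `ℝ`.
  have hb : (fun a : ℝ => φ (max a 0, 0)) = fun a : ℝ => (k : ℝ) * max a 0 :=
    AddCircle.eq_of_coe_comp_eq (p := p) (by fun_prop) (by fun_prop)
      (fun a => by rw [hφ', hbot _ (le_max_right _ _)]) 0 (by simpa using h0)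
  have hr0 : φ (r, 0) = k * r := by simpa [max_eq_left (hp.le.trans hr)] using congrFun hb r
  have hr1 : φ (r, 1) = 0 := congrFun ht r
  have hkr : p ≤ k * r := by
    have : (1 : ℝ) ≤ k := by exact_mod_cast hk
    nlinarith
  obtain ⟨b, hb, hbp⟩ := intermediate_value_Icc' (zero_le_one (α := ℝ))
    (f := fun b => φ (r, b)) (by fun_prop)
    (show p / 2 ∈ Icc (φ (r, 1)) (φ (r, 0)) by rw [hr0, hr1]; constructor <;> linarith)
  exact ⟨b, hb, by rw [← hφ', ← hbp]⟩

/-- A closed submonoid of the circle is a subgroup, hence is the whole circle or finite. -/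
theorem AddCircle.eq_univ_or_exists_nsmul_eq_zero {p : ℝ} [Fact (0 < p)]
    (H : AddSubmonoid (AddCircle p)) (hH : IsClosed (H : Set (AddCircle p))) :
    (H : Set (AddCircle p)) = univ ∨ ∃ k : ℕ, 0 < k ∧ ∀ a ∈ H, k • a = 0 := by
  have hcl : closure (AddSubgroup.closure (H : Set (AddCircle p)) : Set (AddCircle p)) = H := by
    rw [← closure_addSubmonoidClosure_eq_closure_addSubgroupClosure, AddSubmonoid.closure_eq,
      hH.closure_eq]
  by_cases hd : Dense (AddSubgroup.closure (H : Set (AddCircle p)) : Set (AddCircle p))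
  · exact Or.inl (hcl ▸ hd.closure_eq)
  · right
    rw [AddCircle.dense_addSubgroup_iff_ne_zmultiples] at hd
    push Not at hd
    obtain ⟨a, ha, haH⟩ := hd
    refine ⟨addOrderOf a, Nat.pos_of_ne_zero ha, fun b hb => ?_⟩
    have : b ∈ AddSubgroup.zmultiples a := haH ▸ AddSubgroup.subset_closure hb
    obtain ⟨n, rfl⟩ := AddSubgroup.mem_zmultiples_iff.1 this
    rw [smul_comm, addOrderOf_nsmul_eq_zero, smul_zero]

end Lifting

/-! ### Orbits that are periodic up to a scalar -/

section VectorSpace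

variable {𝕜 X : Type*} [RCLike 𝕜] [AddCommGroup X] [Module 𝕜 X] [TopologicalSpace X]
  [IsTopologicalAddGroup X] [ContinuousSMul 𝕜 X]

theorem not_isCompact_univ_of_nontrivial (𝕜 : Type*) {X : Type*} [RCLike 𝕜] [AddCommGroup X]
    [Module 𝕜 X] [TopologicalSpace X] [IsTopologicalAddGroup X] [ContinuousSMul 𝕜 X] [T2Space X]
    [Nontrivial X] :
    ¬ IsCompact (univ : Set X) := by
  intro h
  obtain ⟨x, hx⟩ := exists_ne (0 : X)
  obtain ⟨W, ⟨hW, hWb⟩, hWx⟩ := (nhds_basis_balanced 𝕜 X).mem_iff.1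
    (isOpen_compl_singleton.mem_nhds hx.symm : ({x}ᶜ : Set X) ∈ 𝓝 0)
  obtain ⟨r, hr, hrW⟩ := (h.isVonNBounded 𝕜 hW).exists_pos
  have hc : ‖((r : ℝ) : 𝕜)‖ = r := by simp [abs_of_pos hr]
  have hc0 : ((r : ℝ) : 𝕜) ≠ 0 := by simpa using hr.ne'
  obtain ⟨w, hw, hwx⟩ := hrW ((r : ℝ) : 𝕜) hc.ge (mem_univ (((r : ℝ) : 𝕜) • x))
  have : w = x := smul_right_injective X hc0 hwx
  exact hWx (this ▸ hw) rfl

/-- A path that is multiplied by a scalar `μ` over each time period `s` is not dense. Its values are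
`μ ^ n • y` with `y` in the compact set `K` of the values on `[0, s]`: if `‖μ‖ ≤ 1` they lie in the
compact balanced hull of `K`, and if `‖μ‖ > 1` they stay away from `0` as `0 ∉ K`. The hypothesis
`hzero` holds for the orbits of a linear semigroup. -/
theorem not_denseRange_of_scalar_shift [T2Space X] [Nontrivial X] {c : ℝ≥0 → X}
    (hc : Continuous c) {s : ℝ≥0} (hs : 0 < s) {μ : 𝕜} (hshift : ∀ t, c (t + s) = μ • c t)
    (hzero : ∀ r t, c r = 0 → c (r + t) = 0) : ¬ DenseRange c := by
  intro hd
  have hK : IsCompact (c '' Icc 0 s) := isCompact_Icc.image hc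
  have hiter : ∀ (n : ℕ) (r : ℝ≥0), c (r + n * s) = μ ^ n • c r := by
    intro n r
    induction n with
    | zero => simp
    | succ n ih => rw [Nat.cast_succ, add_mul, one_mul, ← add_assoc, hshift, ih, smul_smul, pow_succ']
  have hrep : ∀ t, ∃ n : ℕ, ∃ y ∈ c '' Icc 0 s, c t = μ ^ n • y := by
    intro t
    have hle : (⌊t / s⌋₊ : ℝ≥0) * s ≤ t := by
      simpa [hs.ne'] using mul_le_mul_left (Nat.floor_le (zero_le (a := t / s))) s
    obtain ⟨r, hr⟩ := exists_add_of_le hle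
    refine ⟨⌊t / s⌋₊, c r, ⟨r, ⟨zero_le, ?_⟩, rfl⟩, ?_⟩
    · have h1 : t < (⌊t / s⌋₊ + 1) * s := by
        rw [← div_lt_iff₀ hs]; exact Nat.lt_floor_add_one _
      rw [add_mul, one_mul] at h1
      nth_rw 1 [hr] at h1
      exact (lt_of_add_lt_add_left h1).le
    · rw [← hiter, add_comm, ← hr]
  rcases le_or_gt ‖μ‖ 1 with hμ | hμ
  · have hB : IsCompact (Metric.closedBall (0 : 𝕜) 1 • (c '' Icc 0 s)) :=
      (isCompact_closedBall 0 1).smul_set hK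
    have hsub : range c ⊆ Metric.closedBall (0 : 𝕜) 1 • (c '' Icc 0 s) := by
      rintro _ ⟨t, rfl⟩
      obtain ⟨n, y, hy, hty⟩ := hrep t
      rw [hty]
      refine smul_mem_smul ?_ hy
      simpa using pow_le_one₀ (norm_nonneg μ) hμ
    refine not_isCompact_univ_of_nontrivial 𝕜 (X := X) ?_
    rw [← hd.closure_range]
    exact hB.of_isClosed_subset isClosed_closure (closure_minimal hsub hB.isClosed)
  · -- If `c` has a zero in `[0, s]`, then `c s = μ • c 0 = 0`, so `c 0 = 0` and `c` is zero throughout.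
    have h0K : (0 : X) ∉ c '' Icc 0 s := by
      rintro ⟨r, ⟨-, hrs⟩, hr⟩
      obtain ⟨u, hu⟩ := exists_add_of_le hrs
      have hμ0 : μ ≠ 0 := norm_pos_iff.1 (zero_lt_one.trans hμ)
      have h1 : c s = 0 := hu ▸ hzero r u hr
      have h2 : c 0 = 0 := by
        have := hshift 0
        rw [zero_add, h1] at this
        exact (smul_eq_zero.1 this.symm).resolve_left hμ0
      have h3 : range c ⊆ {0} := by
        rintro _ ⟨t, rfl⟩
        simpa using hzero 0 t h2
      have h4 := closure_minimal h3 isClosed_singleton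
      rw [hd.closure_range] at h4
      obtain ⟨x, hx⟩ := exists_ne (0 : X)
      exact hx (h4 (mem_univ x))
    obtain ⟨W, ⟨hW, hWb⟩, hWK⟩ := (nhds_basis_balanced 𝕜 X).mem_iff.1
      (hK.isClosed.isOpen_compl.mem_nhds h0K)
    obtain ⟨_, hz, t, rfl⟩ := mem_closure_iff_nhds.1 (hd 0) W hW
    obtain ⟨n, y, hy, hty⟩ := hrep t
    refine hWK ?_ hy
    have hμn : μ ^ n ≠ 0 := pow_ne_zero _ (norm_pos_iff.1 (zero_lt_one.trans hμ))
    have : y = (μ ^ n)⁻¹ • c t := by rw [hty, inv_smul_smul₀ hμn]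
    rw [this]
    refine hWb.smul_mem ?_ hz
    rw [norm_inv, norm_pow]
    exact inv_le_one_of_one_le₀ (one_le_pow₀ hμ.le)

end VectorSpace

/-! ### Operator semigroups -/

section Semigroup

variable {𝕜 X : Type*} [RCLike 𝕜] [AddCommGroup X] [Module 𝕜 X] [TopologicalSpace X]
  {T : ℝ≥0 → X →L[𝕜] X}

theorem IsOperatorSemigroup.apply_zero (hT : IsOperatorSemigroup T) (x : X) : T 0 x = x := by
  simp [hT.map_zero]

theorem IsOperatorSemigroup.apply_add (hT : IsOperatorSemigroup T) (s t : ℝ≥0) (x : X) :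
    T (s + t) x = T s (T t x) := by
  simp [hT.map_add]

theorem IsOperatorSemigroup.apply_comm (hT : IsOperatorSemigroup T) (s t : ℝ≥0) (x : X) :
    T s (T t x) = T t (T s x) := by
  rw [← hT.apply_add, ← hT.apply_add, add_comm]

theorem IsOperatorSemigroup.iterate_apply (hT : IsOperatorSemigroup T) (s : ℝ≥0) (n : ℕ) (x : X) :
    (T s : X → X)^[n] x = T (n * s) x := by
  induction n with
  | zero => simp [hT.apply_zero]
  | succ n ih =>
    rw [Function.iterate_succ_apply', ih, ← hT.apply_add, Nat.cast_succ, add_mul, one_mul,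
      add_comm]

theorem IsOperatorSemigroup.hypercyclicVectors_subset (hT : IsOperatorSemigroup T) (s : ℝ≥0) :
    hypercyclicVectors (T s) ⊆ universalElements (fun (t : ℝ≥0) (x : X) => T t x) := by
  intro x hx
  refine Dense.mono ?_ hx
  rintro _ ⟨n, rfl⟩
  exact ⟨n * s, (hT.iterate_apply s n x).symm⟩

/-! ### Phases along an orbit -/

/-- The closure in `X × ℝ/pℤ` of the orbit of `x` paired with its phase, that is, of the set of all
`(T_t x, t mod p)` with `t ≥ 0`. -/
def phaseClosure (T : ℝ≥0 → X →L[𝕜] X) (p : ℝ) (x : X) : Set (X × AddCircle p) :=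
  closure (range fun t : ℝ≥0 => (T t x, ((t : ℝ) : AddCircle p)))

theorem mem_phaseClosure_self (T : ℝ≥0 → X →L[𝕜] X) (p : ℝ) (x : X) (t : ℝ≥0) :
    (T t x, ((t : ℝ) : AddCircle p)) ∈ phaseClosure T p x :=
  subset_closure ⟨t, rfl⟩

/-- Since each `T_s` moves the phase orbit of `x` into itself, a phase from `x` to `y` and a phase
from `y` to `z` add up to a phase from `x` to `z`. -/
theorem IsOperatorSemigroup.phaseClosure_trans (hT : IsOperatorSemigroup T) {p : ℝ} {x y z : X}
    {a b : AddCircle p} (hxy : (y, a) ∈ phaseClosure T p x) (hyz : (z, b) ∈ phaseClosure T p y) :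
    (z, a + b) ∈ phaseClosure T p x := by
  have key : ∀ s : ℝ≥0, (T s y, a + ((s : ℝ) : AddCircle p)) ∈ phaseClosure T p x := by
    intro s
    have hcont : Continuous fun q : X × AddCircle p => (T s q.1, q.2 + ((s : ℝ) : AddCircle p)) :=
      by fun_prop
    refine map_mem_closure (f := fun q : X × AddCircle p => (T s q.1, q.2 + ((s : ℝ) : AddCircle p)))
      hcont hxy ?_
    rintro _ ⟨t, rfl⟩
    exact ⟨s + t, by simp [hT.apply_add, add_comm]⟩
  have hcont : Continuous fun q : X × AddCircle p => (q.1, a + q.2) := by fun_prop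
  have := map_mem_closure (t := phaseClosure T p x) hcont hyz
    (by rintro _ ⟨t, rfl⟩; exact key t)
  rwa [phaseClosure, closure_closure] at this

/-- Compactness of the circle gives every point of `X` a phase as seen from a universal vector. -/
theorem exists_mem_phaseClosure {p : ℝ} [Fact (0 < p)] {x : X}
    (hx : x ∈ universalElements (fun (t : ℝ≥0) (x : X) => T t x)) (y : X) :
    ∃ a, (y, a) ∈ phaseClosure T p x := by
  have hcl : IsClosed (Prod.fst '' phaseClosure T p x) :=
    isClosedMap_fst_of_compactSpace _ isClosed_closure
  have hsub : range (fun t : ℝ≥0 => T t x) ⊆ Prod.fst '' phaseClosure T p x := by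
    rintro _ ⟨t, rfl⟩
    exact ⟨_, mem_phaseClosure_self T p x t, rfl⟩
  obtain ⟨⟨_, a⟩, ha, rfl⟩ := closure_minimal hsub hcl (hx y)
  exact ⟨a, ha⟩

/-- The phases `a ∈ ℝ/pℤ` such that `(x, a)` is a limit of points `(T_t x, t mod p)`. Limits with
bounded `t` are not excluded; in particular `0` is always a return phase. -/
def IsOperatorSemigroup.returnPhases (hT : IsOperatorSemigroup T) (p : ℝ) (x : X) :
    AddSubmonoid (AddCircle p) where
  carrier := {a | (x, a) ∈ phaseClosure T p x}
  zero_mem' := by simpa [hT.apply_zero] using mem_phaseClosure_self T p x 0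
  add_mem' := hT.phaseClosure_trans

theorem IsOperatorSemigroup.isClosed_returnPhases (hT : IsOperatorSemigroup T) (p : ℝ) (x : X) :
    IsClosed (hT.returnPhases p x : Set (AddCircle p)) :=
  isClosed_closure.preimage (f := fun a : AddCircle p => (x, a)) (by fun_prop)

/-! ### Density of the range of a segment operator -/

variable [IsTopologicalAddGroup X] [ContinuousSMul 𝕜 X]

/-- The point `(1 - b) S + b I` of the line through `S` and the identity. -/
def segmentOperator (S : X →L[𝕜] X) (b : ℝ) : X →L[𝕜] X :=
  ((1 - b : ℝ) : 𝕜) • S + ((b : ℝ) : 𝕜) • ContinuousLinearMap.id 𝕜 X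

theorem segmentOperator_apply (S : X →L[𝕜] X) (b : ℝ) (x : X) :
    segmentOperator S b x = ((1 - b : ℝ) : 𝕜) • S x + ((b : ℝ) : 𝕜) • x := rfl

theorem IsOperatorSemigroup.apply_segmentOperator (hT : IsOperatorSemigroup T) (s t : ℝ≥0) (b : ℝ)
    (x : X) : T t (segmentOperator (T s) b x) = segmentOperator (T s) b (T t x) := by
  simp only [segmentOperator_apply, _root_.map_add, map_smul, hT.apply_comm t s]

/-- If the range of `(1 - b) T_s + b I` were not dense, then `T_s` would act as a scalar on the
nonzero Hausdorff quotient `X ⧸ M` by the closure `M` of the range, and the dense image of the orbit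
of `x` there would be periodic up to that scalar. -/
theorem IsOperatorSemigroup.denseRange_segmentOperator (hT : IsOperatorSemigroup T)
    (hc : IsStronglyContinuous T) {x : X}
    (hx : x ∈ universalElements (fun (t : ℝ≥0) (x : X) => T t x)) (s : ℝ≥0) (b : ℝ) :
    DenseRange (segmentOperator (T s) b) := by
  have hself : ∀ y, b = 1 ∨ s = 0 → segmentOperator (T s) b y = y := by
    rintro y (rfl | rfl)
    · simp [segmentOperator_apply]
    · rw [segmentOperator_apply, hT.apply_zero, ← add_smul]
      simp
  by_cases h : b = 1 ∨ s = 0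
  · exact Function.Surjective.denseRange fun y => ⟨y, hself y h⟩
  push Not at h
  set S := segmentOperator (T s) b with hS
  set M : Submodule 𝕜 X := (LinearMap.range (S : X →ₗ[𝕜] X)).topologicalClosure with hM
  have hMc : IsClosed (M : Set X) := Submodule.isClosed_topologicalClosure _
  have hSM : ∀ y, S y ∈ M := fun y =>
    Submodule.le_topologicalClosure _ (LinearMap.mem_range_self (S : X →ₗ[𝕜] X) y)
  have hMinv : ∀ t, ∀ y ∈ M, T t y ∈ M := by
    intro t y hy
    refine map_mem_closure (T t).continuous hy ?_
    rintro _ ⟨z, rfl⟩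
    exact ⟨T t z, (hT.apply_segmentOperator s t b z).symm⟩
  by_contra hnd
  have hMtop : M ≠ ⊤ := by
    intro hMtop
    refine hnd (dense_iff_closure_eq.2 ?_)
    have := congrArg (fun N : Submodule 𝕜 X => (N : Set X)) hMtop
    rw [Submodule.topologicalClosure_coe] at this
    exact this
  have : Nontrivial (X ⧸ M) := Submodule.Quotient.nontrivial_iff.2 hMtop
  have hb : ((1 - b : ℝ) : 𝕜) ≠ 0 := by
    simpa only [ne_eq, RCLike.ofReal_eq_zero, sub_eq_zero] using fun h' => h.1 h'.symm
  refine not_denseRange_of_scalar_shift (c := fun t => M.mkQ (T t x))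
    (μ := -(((1 - b : ℝ) : 𝕜)⁻¹ * ((b : ℝ) : 𝕜)))
    (M.continuous_mkQ.comp (hc x)) (pos_iff_ne_zero.2 h.2) (fun t => ?_) (fun r t hr => ?_) ?_
  · rw [← map_smul, ← sub_eq_zero, ← map_sub, ← LinearMap.mem_ker, Submodule.ker_mkQ]
    have := M.smul_mem ((1 - b : ℝ) : 𝕜)⁻¹ (hSM (T t x))
    rw [hS, segmentOperator_apply, smul_add, inv_smul_smul₀ hb, smul_smul] at this
    rwa [add_comm t s, hT.apply_add, neg_smul, sub_neg_eq_add]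
  · rw [← LinearMap.mem_ker, Submodule.ker_mkQ] at hr ⊢
    rw [add_comm, hT.apply_add]
    exact hMinv t _ hr
  · exact (M.mkQ_surjective.denseRange).comp hx M.continuous_mkQ

theorem IsOperatorSemigroup.segmentOperator_mem_universalElements (hT : IsOperatorSemigroup T)
    (hc : IsStronglyContinuous T) {x : X}
    (hx : x ∈ universalElements (fun (t : ℝ≥0) (x : X) => T t x)) (s : ℝ≥0) (b : ℝ) :
    segmentOperator (T s) b x ∈ universalElements (fun (t : ℝ≥0) (x : X) => T t x) := by
  have := (hT.denseRange_segmentOperator hc hx s b).comp hx (segmentOperator (T s) b).continuous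
  refine this.mono ?_
  rintro _ ⟨t, rfl⟩
  exact ⟨t, hT.apply_segmentOperator s t b x⟩

/-! ### The orbit paired with its phase is dense -/

/-- If all return phases of `x` were `k`-torsion, then `k` times the phase would be a well-defined
continuous function `f` from the universal vectors to the circle, with `f (T_t x) = k t mod p`. Its
composition with the cone `(a, b) ↦ (1 - b) T_a x + b x` of universal vectors over the orbit
satisfies the hypotheses of `AddCircle.exists_eq_half_of_square`. But when `T_a x` is close to `x`,
the whole segment from `T_a x` to `x` is close to `x`, where `f` is close to `0`. -/
theorem IsOperatorSemigroup.not_forall_returnPhases_nsmul_eq_zero [T2Space X]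
    (hT : IsOperatorSemigroup T)
    (hc : IsStronglyContinuous T) {p : ℝ≥0} [Fact (0 < (p : ℝ))] {x : X}
    (hx : x ∈ universalElements (fun (t : ℝ≥0) (x : X) => T t x)) {k : ℕ} (hk : 0 < k) :
    ¬ ∀ a ∈ hT.returnPhases p x, k • a = 0 := by
  intro hH
  have hp : (0 : ℝ) < p := Fact.out
  set U := universalElements (fun (t : ℝ≥0) (x : X) => T t x)
  have huniq : ∀ y ∈ U, ∀ a b, (y, a) ∈ phaseClosure T p x → (y, b) ∈ phaseClosure T p x →
      k • a = k • b := by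
    intro y hy a b ha hb
    obtain ⟨d, hd⟩ := exists_mem_phaseClosure (p := (p : ℝ)) hy x
    have h1 := hH _ (hT.phaseClosure_trans ha hd)
    have h2 := hH _ (hT.phaseClosure_trans hb hd)
    rw [nsmul_add] at h1 h2
    exact add_right_cancel (h1.trans h2.symm)
  choose g hg using fun y : U => exists_mem_phaseClosure (p := (p : ℝ)) hx (y : X)
  set f : U → AddCircle (p : ℝ) := fun y => k • g y
  have hfeq : ∀ (y : U) a, ((y : X), a) ∈ phaseClosure T p x → f y = k • a := fun y a ha =>
    huniq y y.2 _ _ (hg y) ha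
  -- The graph of `f` is closed in `U × ℝ/pℤ`, and the circle is compact.
  have hfc : Continuous f := by
    refine continuous_iff_isClosed.2 fun D hD => ?_
    have h1 : IsClosed (Prod.fst '' (phaseClosure T p x ∩ {q | k • q.2 ∈ D})) :=
      isClosedMap_fst_of_compactSpace _
        (isClosed_closure.inter (hD.preimage (by fun_prop)))
    convert h1.preimage continuous_subtype_val using 1
    ext y
    constructor
    · intro hy
      exact ⟨(y, g y), ⟨hg y, hy⟩, rfl⟩
    · rintro ⟨⟨_, a⟩, ⟨ha, haD⟩, rfl⟩
      rw [mem_preimage, hfeq y a ha]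
      exact haD
  have hmem : ∀ s b, segmentOperator (T s) b x ∈ U := fun s b =>
    hT.segmentOperator_mem_universalElements hc hx s b
  set G : ℝ × ℝ → AddCircle (p : ℝ) := fun q => f ⟨_, hmem q.1.toNNReal q.2⟩ with hG
  have hGc : Continuous G := by
    refine hfc.comp (Continuous.subtype_mk ?_ _)
    simp only [segmentOperator_apply]
    have := hc x
    have h2 : Continuous fun q : ℝ × ℝ => T q.1.toNNReal x :=
      this.comp (continuous_real_toNNReal.comp continuous_fst)
    have h3 : Continuous fun q : ℝ × ℝ => (((1 - q.2 : ℝ)) : 𝕜) :=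
      RCLike.continuous_ofReal.comp (by fun_prop)
    have h4 : Continuous fun q : ℝ × ℝ => ((q.2 : ℝ) : 𝕜) :=
      RCLike.continuous_ofReal.comp (by fun_prop)
    exact (h3.smul h2).add (h4.smul continuous_const)
  have hGorbit : ∀ (q : ℝ × ℝ) (t : ℝ≥0), segmentOperator (T q.1.toNNReal) q.2 x = T t x →
      G q = ((k * t : ℝ) : AddCircle (p : ℝ)) := by
    intro q t h
    rw [hG]
    dsimp only
    rw [hfeq _ (t : ℝ) (by simpa only [h] using mem_phaseClosure_self T p x t)]
    rw [← AddCircle.coe_nsmul, nsmul_eq_mul]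
  have hleft : ∀ b, G (0, b) = 0 := fun b => by
    have := hGorbit (0, b) 0 (by
      simp only [segmentOperator_apply, Real.toNNReal_zero, hT.apply_zero, ← add_smul]
      simp)
    simpa using this
  have htop : ∀ a, G (a, 1) = 0 := fun a => by
    have := hGorbit (a, 1) 0 (by simp [segmentOperator_apply, hT.apply_zero])
    simpa using this
  have hbot : ∀ a, 0 ≤ a → G (a, 0) = ((k * a : ℝ) : AddCircle (p : ℝ)) := fun a ha => by
    have := hGorbit (a, 0) a.toNNReal (by simp [segmentOperator_apply])
    simpa [Real.coe_toNNReal a ha] using this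
  have hne : ((p / 2 : ℝ) : AddCircle (p : ℝ)) ≠ 0 := by
    intro h
    obtain ⟨n, hn⟩ := (AddCircle.coe_eq_zero_of_pos_iff (p : ℝ) hp (by linarith)).1 h
    rw [nsmul_eq_mul] at hn
    have h2 : (n : ℝ) * 2 = 1 := by
      have : ((n : ℝ) * 2 - 1) * p = 0 := by linarith
      have := (mul_eq_zero.1 this).resolve_right hp.ne'
      linarith
    have h3 : n * 2 = 1 := by exact_mod_cast h2
    omega
  have hfx : f ⟨x, hx⟩ = 0 := by
    have := hfeq ⟨x, hx⟩ 0 (hT.returnPhases p x).zero_mem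
    simpa using this
  have hnhds : {y : U | f y ≠ ((p / 2 : ℝ) : AddCircle (p : ℝ))} ∈ 𝓝 (⟨x, hx⟩ : U) :=
    (isOpen_ne_fun hfc continuous_const).mem_nhds (by
      rw [mem_ofPred_eq, hfx]; exact hne.symm)
  rw [nhds_subtype_eq_comap] at hnhds
  obtain ⟨N, hN, hNsub⟩ := hnhds
  have hN0 : (fun w => x + w) ⁻¹' N ∈ 𝓝 (0 : X) :=
    (continuous_const.add continuous_id).continuousAt.preimage_mem_nhds (by simpa using hN)
  obtain ⟨W, ⟨hW, hWb⟩, hWN⟩ := (nhds_basis_balanced 𝕜 X).mem_iff.1 hN0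
  -- The return to `x` has to happen at a time at least `p`, so it is sought along the orbit of
  -- `T_p x`, which is universal as well.
  have hTp : T p x ∈ U := by
    simpa [segmentOperator_apply] using hmem p 0
  obtain ⟨_, hz, t, rfl⟩ := mem_closure_iff_nhds.1 (hTp x) ((fun y => y - x) ⁻¹' W)
    ((continuous_id.sub continuous_const).continuousAt.preimage_mem_nhds (by simpa using hW))
  obtain ⟨b, ⟨hb0, hb1⟩, hGb⟩ := AddCircle.exists_eq_half_of_square G hGc hleft htop hk hbot
    (r := ((t + p : ℝ≥0) : ℝ)) (by simp)
  refine hNsub (show segmentOperator (T (Real.toNNReal ((t + p : ℝ≥0) : ℝ))) b x ∈ N from ?_) hGb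
  have hw := hWN (hWb.smul_mem (a := ((1 - b : ℝ) : 𝕜))
    (by rw [RCLike.norm_ofReal, abs_le]; constructor <;> linarith) hz)
  rw [mem_preimage] at hw
  convert! hw using 1
  rw [Real.toNNReal_coe, segmentOperator_apply, hT.apply_add, smul_sub]
  have : x = ((1 - b : ℝ) : 𝕜) • x + ((b : ℝ) : 𝕜) • x := by rw [← add_smul]; simp
  nth_rw 3 [this]
  abel

/-- For a universal vector, position and phase are simultaneously dense. Strong continuity of the
semigroup is enough. -/
theorem IsOperatorSemigroup.phaseClosure_eq_univ [T2Space X] (hT : IsOperatorSemigroup T)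
    (hc : IsStronglyContinuous T) {p : ℝ≥0} (hp : 0 < p) {x : X}
    (hx : x ∈ universalElements (fun (t : ℝ≥0) (x : X) => T t x)) :
    phaseClosure T p x = univ := by
  have : Fact (0 < (p : ℝ)) := ⟨hp⟩
  rcases AddCircle.eq_univ_or_exists_nsmul_eq_zero _ (hT.isClosed_returnPhases p x) with h | h
  · refine eq_univ_of_forall fun ⟨y, a⟩ => ?_
    obtain ⟨b, hb⟩ := exists_mem_phaseClosure (p := (p : ℝ)) hx y
    have : (x, a - b) ∈ phaseClosure T p x := h.ge (mem_univ (a - b))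
    simpa using hT.phaseClosure_trans this hb
  · obtain ⟨k, hk, hkH⟩ := h
    exact absurd hkH (hT.not_forall_returnPhases_nsmul_eq_zero hc hx hk)

/-! ### From the semigroup to its single operators -/

theorem IsOperatorSemigroup.mem_hypercyclicVectors [T2Space X] (hT : IsOperatorSemigroup T)
    (hc : IsStronglyContinuous T)
    (hj : ∀ z : X, ContinuousAt (fun q : ℝ≥0 × X => T q.1 q.2) (0, z)) {p : ℝ≥0} (hp : 0 < p)
    {x : X} (hx : x ∈ universalElements (fun (t : ℝ≥0) (x : X) => T t x)) :
    x ∈ hypercyclicVectors (T p) := by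
  have : Fact (0 < (p : ℝ)) := ⟨hp⟩
  intro z
  rw [mem_closure_iff_nhds]
  intro V hV
  have hV' := hj z (by simpa [hT.apply_zero] using hV)
  rw [mem_map, nhds_prod_eq] at hV'
  obtain ⟨R, hR, Z, hZ, hRZ⟩ := mem_prod_iff.1 hV'
  obtain ⟨ε, hε, hεR⟩ := Metric.mem_nhds_iff.1 hR
  set δ : ℝ := min ε p
  have hδ0 : 0 < δ := lt_min hε hp
  -- If `T_t x` is close to `z` and `t = r` modulo `p` with `r < 0` small, then `t - r = n p` for some
  -- `n`, and `T_{n p} x = T_{-r} (T_t x)` is close to `z` too.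
  have harc : IsOpen ((fun r : ℝ => (r : AddCircle (p : ℝ))) '' Ioo (-δ) 0) :=
    QuotientAddGroup.isOpenMap_coe _ isOpen_Ioo
  have hm : (z, ((-(δ / 2) : ℝ) : AddCircle (p : ℝ))) ∈ phaseClosure T p x := by
    rw [hT.phaseClosure_eq_univ hc hp hx]; trivial
  obtain ⟨_, ⟨htZ, r, ⟨hr1, hr2⟩, hrt⟩, t, rfl⟩ := mem_closure_iff_nhds.1 hm _
    (prod_mem_nhds hZ (harc.mem_nhds ⟨-(δ / 2), ⟨by linarith, by linarith⟩, rfl⟩))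
  have hsub : ((t - r : ℝ) : AddCircle (p : ℝ)) = 0 := by
    rw [AddCircle.coe_sub, sub_eq_zero]; exact hrt.symm
  obtain ⟨n, hn⟩ := (AddCircle.coe_eq_zero_of_pos_iff (p : ℝ) (show (0 : ℝ) < p from hp)
    (show 0 < (t : ℝ) - r by have := t.2; linarith)).1 hsub
  have hn' : (n : ℝ≥0) * p = (-r).toNNReal + t := by
    apply NNReal.coe_injective
    push_cast
    rw [Real.coe_toNNReal _ (by linarith), ← nsmul_eq_mul, hn]
    ring
  refine ⟨T (n * p) x, ?_, n, hT.iterate_apply p n x⟩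
  rw [hn', hT.apply_add]
  refine hRZ (show ((-r).toNNReal, T t x) ∈ R ×ˢ Z from ⟨hεR ?_, htZ⟩)
  rw [Metric.mem_ball, NNReal.dist_eq, Real.coe_toNNReal _ (by linarith), NNReal.coe_zero, sub_zero,
    abs_of_pos (by linarith)]
  have := min_le_left ε (p : ℝ)
  linarith

theorem IsOperatorSemigroup.hypercyclicVectors_eq [T2Space X] (hT : IsOperatorSemigroup T)
    (hc : IsStronglyContinuous T)
    (hj : ∀ z : X, ContinuousAt (fun q : ℝ≥0 × X => T q.1 q.2) (0, z)) {p : ℝ≥0} (hp : 0 < p) :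
    hypercyclicVectors (T p) = universalElements (fun (t : ℝ≥0) (x : X) => T t x) :=
  (hT.hypercyclicVectors_subset p).antisymm fun _ => hT.mem_hypercyclicVectors hc hj hp

/-! ### Local equicontinuity on Baire spaces -/

/-- Uniform boundedness principle for `T_r`, `r ∈ [0, 1]`, on a Baire topological vector space that
need not be locally convex. -/
theorem IsStronglyContinuous.exists_mapsTo_nhds_zero [BaireSpace X] (hc : IsStronglyContinuous T)
    {W : Set X} (hW : W ∈ 𝓝 0) : ∃ V ∈ 𝓝 (0 : X), ∀ r ∈ Icc (0 : ℝ≥0) 1, MapsTo (T r) V W := by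
  obtain ⟨W₀, hW₀, hsub⟩ := exists_nhds_half_neg hW
  obtain ⟨W₁, ⟨hW₁, hcl, hbal⟩, hW₁₀⟩ := (nhds_basis_closed_balanced 𝕜 X).mem_iff.1 hW₀
  set E : ℕ → Set X := fun n => ⋂ r ∈ Icc (0 : ℝ≥0) 1, {v | (((n : ℝ) + 1 : ℝ) : 𝕜)⁻¹ • T r v ∈ W₁}
  have hnorm : ∀ n : ℕ, ‖(((n : ℝ) + 1 : ℝ) : 𝕜)‖ = n + 1 := fun n => by
    rw [RCLike.norm_ofReal, abs_of_pos (by positivity)]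
  have hne : ∀ n : ℕ, (((n : ℝ) + 1 : ℝ) : 𝕜) ≠ 0 := fun n => by
    rw [← norm_pos_iff, hnorm]; positivity
  have hEc : ∀ n, IsClosed (E n) := fun n =>
    isClosed_biInter fun r _ => hcl.preimage ((T r).continuous.const_smul _)
  have hEu : ⋃ n, E n = univ := by
    refine eq_univ_of_forall fun v => ?_
    obtain ⟨ρ, hρ, hρW⟩ :=
      (((isCompact_Icc (a := (0 : ℝ≥0)) (b := 1)).image (hc v)).isVonNBounded 𝕜 hW₁).exists_pos
    obtain ⟨n, hn⟩ := exists_nat_ge ρ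
    refine mem_iUnion.2 ⟨n, mem_iInter₂.2 fun r hr => ?_⟩
    obtain ⟨w, hw, hwe⟩ := hρW (((n : ℝ) + 1 : ℝ) : 𝕜) (by rw [hnorm]; linarith)
      (mem_image_of_mem _ hr)
    rw [mem_ofPred_eq, ← hwe]
    simpa only [inv_smul_smul₀ (hne n)] using hw
  obtain ⟨n, a, ha⟩ := nonempty_interior_of_iUnion_of_closed hEc hEu
  have haE := interior_subset ha
  refine ⟨(fun u => a + (((n : ℝ) + 1 : ℝ) : 𝕜) • u) ⁻¹' E n, ?_, fun r hr u hu => ?_⟩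
  · refine ContinuousAt.preimage_mem_nhds (by fun_prop) ?_
    simpa using mem_interior_iff_mem_nhds.1 ha
  · have h1 := hW₁₀ (mem_iInter₂.1 hu r hr)
    have h2 := hW₁₀ (mem_iInter₂.1 haE r hr)
    have := hsub _ h1 _ h2
    rw [_root_.map_add (T r), map_smul (T r), smul_add, inv_smul_smul₀ (hne n),
      add_sub_cancel_left] at this
    exact this

theorem IsStronglyContinuous.continuousAt_zero [BaireSpace X] (hT : IsOperatorSemigroup T)
    (hc : IsStronglyContinuous T) (z : X) :
    ContinuousAt (fun q : ℝ≥0 × X => T q.1 q.2) (0, z) := by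
  have h1 : Tendsto (fun q : ℝ≥0 × X => T q.1 (q.2 - z)) (𝓝 (0, z)) (𝓝 0) := by
    intro W hW
    obtain ⟨V, hV, hVW⟩ := hc.exists_mapsTo_nhds_zero hW
    have hV' : (fun q : ℝ≥0 × X => q.2 - z) ⁻¹' V ∈ 𝓝 (0, z) :=
      ContinuousAt.preimage_mem_nhds (by fun_prop) (by simpa using hV)
    have hI : (Prod.fst : ℝ≥0 × X → ℝ≥0) ⁻¹' Iio 1 ∈ 𝓝 (0, z) :=
      continuousAt_fst.preimage_mem_nhds (Iio_mem_nhds one_pos)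
    change ∀ᶠ q : ℝ≥0 × X in 𝓝 (0, z), T q.1 (q.2 - z) ∈ W
    filter_upwards [hV', hI] with q hq hq1
    exact hVW q.1 ⟨zero_le, le_of_lt hq1⟩ hq
  have h2 : Tendsto (fun q : ℝ≥0 × X => T q.1 z) (𝓝 (0, z)) (𝓝 z) := by
    have := ((hc z).comp continuous_fst).tendsto ((0, z) : ℝ≥0 × X)
    simpa [Function.comp_def, hT.apply_zero] using this
  have h3 := h1.add h2
  simp only [map_sub, sub_add_cancel, zero_add] at h3
  simpa [ContinuousAt, hT.apply_zero] using h3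

end Semigroup

theorem proposition4p11 {𝕜 X : Type*} [RCLike 𝕜] [AddCommGroup X] [Module 𝕜 X]
    [TopologicalSpace X] [IsTopologicalAddGroup X] [ContinuousSMul 𝕜 X] [T2Space X]
    (T : ℝ≥0 → X →L[𝕜] X) (hT : IsOperatorSemigroup T) :
    -- jointly continuous semigroups
    (Continuous (fun p : ℝ≥0 × X => T p.1 p.2) →
      (∀ t s : ℝ≥0, 0 < t → 0 < s → hypercyclicVectors (T t) = hypercyclicVectors (T s)) ∧
      ((∀ t : ℝ≥0, 0 < t → ¬ IsHypercyclic (T t)) ∨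
        ((∀ t : ℝ≥0, 0 < t → IsHypercyclic (T t)) ∧
          ∀ t s : ℝ≥0, 0 < t → 0 < s →
            hypercyclicVectors (T t) = hypercyclicVectors (T s)))) ∧
    -- the Conejero-Müller-Peris theorem
    (BaireSpace X → TopologicalSpace.SeparableSpace X → TopologicalSpace.MetrizableSpace X →
      IsStronglyContinuous T → IsUniversalFamily (fun (t : ℝ≥0) (x : X) => T t x) →
      (∀ t : ℝ≥0, 0 < t → IsHypercyclic (T t)) ∧
      ∀ t s : ℝ≥0, 0 < t → 0 < s →
        hypercyclicVectors (T t) = hypercyclicVectors (T s)) := by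
  constructor
  · intro hj
    have hc : IsStronglyContinuous T := fun x => hj.comp (Continuous.prodMk_left x)
    have heq : ∀ t : ℝ≥0, 0 < t → hypercyclicVectors (T t) =
        universalElements (fun (t : ℝ≥0) (x : X) => T t x) :=
      fun t ht => hT.hypercyclicVectors_eq hc (fun z => hj.continuousAt) ht
    have hall : ∀ t s : ℝ≥0, 0 < t → 0 < s →
        hypercyclicVectors (T t) = hypercyclicVectors (T s) :=
      fun t s ht hs => (heq t ht).trans (heq s hs).symm
    refine ⟨hall, ?_⟩
    by_cases h : IsUniversalFamily (fun (t : ℝ≥0) (x : X) => T t x)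
    · exact Or.inr ⟨fun t ht => by rwa [IsHypercyclic, heq t ht], hall⟩
    · exact Or.inl fun t ht => by rwa [IsHypercyclic, heq t ht]
  · intro _ _ _ hc h
    have heq : ∀ t : ℝ≥0, 0 < t → hypercyclicVectors (T t) =
        universalElements (fun (t : ℝ≥0) (x : X) => T t x) :=
      fun t ht => hT.hypercyclicVectors_eq hc (hc.continuousAt_zero hT) ht
    exact ⟨fun t ht => by rwa [IsHypercyclic, heq t ht],
      fun t s ht hs => (heq t ht).trans (heq s hs).symm⟩
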